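/- Let $I$ be an infinite set and let $\{H_i\}_{i\in I}$ be a family of non-zero complex Hilbert spaces. Let $S(H_i)$ be the unit sphere of $H_i$, and let $\prod^{\rm eu}H_i$ be the set of $x\in\prod_{i\in I}H_i$ with $\|x_i\|=1$ for all but finitely many $i$. *Algebraic side.* For $x,y\in\prod_i S(H_i)$ write $x\sim y$ if $x_i=y_i$ for all but finitely many $i$, and put $\Omega^{\rm un}_{I;H}:=\prod_i S(H_i)/\!\sim$. Let $\bigotimes_{i\in I}H_i$, with the canonical multilinear map $\Theta_H:x\mapsto\otimes_i x_i$, be the algebraic tensor product, i.e. the vector space that is universal for maps on $\prod_i H_i$ that are linear in each variable. Let $\bigotimes^{\rm un}_{i\in I}H_i:={\rm span}\,\Theta_H(\prod_i S(H_i))$, which contains $\Theta_H(\prod^{\rm eu}H_i)$; for $\mu=[u]_\sim\in\Omega^{\rm un}_{I;H}$ let $\bigotimes^{\mu}_{i\in I}H_i$ be the span of those $\Theta_H(x)$, $x\in\prod_i H_i$, for which $x_i=u_i$ for all but finitely many $i$. The space $\bigotimes^{\rm un}_{i\in I}H_i$ carries the inner product $\langle\cdot,\cdot\rangle_{\phi_1}$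 that is determined by $\langle\otimes_i x_i,\otimes_i y_i\rangle_{\phi_1}=\prod_i\langle x_i,y_i\rangle$ if $\langle x_i,y_i\rangle=1$ for all but finitely many $i$, and $=0$ otherwise. Let $\bar\bigotimes^{\mu}_{i\in I}H_i$ be the completion of $\bigotimes^{\mu}_{i\in I}H_i$ for it. *Analytic side (von Neumann).* A $C_0$-sequence is an $x\in\prod_i H_i$ such that $\sum_i\big|\|x_i\|-1\big|$ converges; for $C_0$-sequences write $x\approx y$ if $\sum_i|\langle x_i,y_i\rangle-1|$ converges. This is an equivalence relation; let $\Gamma_{I;H}$ be the set of its classes $[x]_\approx$. The infinite direct product $\prod\otimes_{i\in I}H_i$ is the Hilbert space generated by vectors $\prod\otimes_i x_i$, one for every $C_0$-sequence $x$, with dense linear span and with $\langle\prod\otimes_i x_i,\prod\otimes_i y_i\rangle=\prod_i\langle x_i,y_i\rangle$ if $x\approx y$, and $=0$ otherwise. For $\mathfrak C\in\Gamma_{I;H}$ the incomplete product $\prod\otimes^{\mathfrak C}_{i\in I}H_i$ is the closed linear span of $\{\prod\otimes_i x_i: x\in\mathfrak C\}$. Every element of $\prod^{\rm eu}H_i$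 is a $C_0$-sequence. Then: (a) $[x]_\sim\mapsto[x]_\approx$ ($x\in\prod_i S(H_i)$) is a well-defined surjection $\kappa_H:\Omega^{\rm un}_{I;H}\to\Gamma_{I;H}$, and for all $x,y\in\prod_i S(H_i)$ there is a bijection between $\kappa_H^{-1}([x]_\approx)$ and $\kappa_H^{-1}([y]_\approx)$. (b) There is a linear map $\tilde\Upsilon:\bigotimes^{\rm un}_{i\in I}H_i\to\prod\otimes_{i\in I}H_i$ with $\tilde\Upsilon(\otimes_i x_i)=\prod\otimes_i x_i$ for all $x\in\prod^{\rm eu}H_i$, and for every $\mu\in\Omega^{\rm un}_{I;H}$ the restriction of $\tilde\Upsilon$ to $\bigotimes^{\mu}_{i\in I}H_i$ extends to a Hilbert space isomorphism $\tilde\Upsilon^{\mu}:\bar\bigotimes^{\mu}_{i\in I}H_i\to\prod\otimes^{\kappa_H(\mu)}_{i\in I}H_i$. -/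

import Mathlib

/-! ## Sequences and their equivalence relations -/

section Sequences

variable {I : Type*} (H : I → Type*) [∀ i, NormedAddCommGroup (H i)]
  [∀ i, InnerProductSpace ℂ (H i)]

/-- The product of the unit spheres of the `H i`. -/
@[ext]
structure UnitSeq where
  val : ∀ i, H i
  norm_eq_one : ∀ i, ‖val i‖ = 1

/-- The families `x` with `‖x i‖ = 1` for all but finitely many `i`. -/
@[ext]
structure EuSeq where
  val : ∀ i, H i
  finite_ne : {i | ‖val i‖ ≠ 1}.Finite

/-- von Neumann's `C₀`-sequences: the families `x` for which `∑ i, |‖x i‖ - 1|` converges. -/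
@[ext]
structure C0Seq where
  val : ∀ i, H i
  summable : Summable fun i => |‖val i‖ - 1|

variable {H}

/-- `x ∼ y`: the unit families `x` and `y` agree at all but finitely many indices. -/
instance UnitSeq.setoid : Setoid (UnitSeq H) where
  r x y := {i | x.1 i ≠ y.1 i}.Finite
  iseqv :=
    { refl := fun x => by simp
      symm := fun {x y} h => by
        refine h.subset fun i hi => ?_
        exact fun h' => hi h'.symm
      trans := fun {x y z} h₁ h₂ => by
        refine (h₁.union h₂).subset fun i hi => ?_
        by_contra hcon
        simp only [Set.mem_union, Set.mem_ofPred_eq, not_or, not_not] at hcon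
        exact hi (hcon.1.trans hcon.2) }

theorem C0Seq.summable_sq (x : C0Seq H) : Summable fun i => |‖x.1 i‖ ^ 2 - 1| := by
  have h := x.2
  have h1 : ∀ᶠ i in Filter.cofinite, |‖x.1 i‖ - 1| < 1 :=
    h.tendsto_cofinite_zero.eventually (gt_mem_nhds one_pos)
  refine Summable.of_norm_bounded_eventually (g := fun i => 3 * |‖x.1 i‖ - 1|) (h.mul_left 3) ?_
  filter_upwards [h1] with i hi
  have e : ‖x.1 i‖ ^ 2 - 1 = (‖x.1 i‖ + 1) * (‖x.1 i‖ - 1) := by ring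
  have hn := norm_nonneg (x.1 i)
  rw [Real.norm_eq_abs, abs_abs, e, abs_mul, abs_of_nonneg (by linarith : 0 ≤ ‖x.1 i‖ + 1)]
  have := (abs_lt.1 hi).2
  exact mul_le_mul_of_nonneg_right (by linarith) (abs_nonneg _)

theorem C0Seq.summable_sub_sq (x y : C0Seq H)
    (h : Summable fun i => ‖inner ℂ (x.1 i) (y.1 i) - 1‖) :
    Summable fun i => ‖x.1 i - y.1 i‖ ^ 2 := by
  refine Summable.of_nonneg_of_le (fun i => by positivity) (fun i => ?_)
    ((x.summable_sq.add y.summable_sq).add (h.mul_left 2))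
  have h1 := @norm_sub_sq ℂ _ _ _ _ (x.1 i) (y.1 i)
  have h2 := le_abs_self (‖x.1 i‖ ^ 2 - 1)
  have h3 := le_abs_self (‖y.1 i‖ ^ 2 - 1)
  have h4 := (abs_le.1 (Complex.abs_re_le_norm (inner ℂ (x.1 i) (y.1 i) - 1))).1
  simp only [Complex.sub_re, Complex.one_re, RCLike.re_to_complex] at h1 h4
  linarith

/-- `x ≈ y`: the series `∑ i, |⟪x i, y i⟫ - 1|` converges. -/
instance C0Seq.setoid : Setoid (C0Seq H) where
  r x y := Summable fun i => ‖inner ℂ (x.1 i) (y.1 i) - 1‖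
  iseqv :=
    { refl := fun x => by
        refine x.summable_sq.congr fun i => ?_
        rw [inner_self_eq_norm_sq_to_K, ← Real.norm_eq_abs, ← Complex.norm_real]
        simp
      symm := fun {x y} h => by
        refine h.congr fun i => ?_
        rw [← inner_conj_symm, ← Complex.norm_conj]
        simp
      trans := fun {x y z} h₁ h₂ => by
        have h₂' : Summable fun i => ‖inner ℂ (z.1 i) (y.1 i) - 1‖ := by
          refine h₂.congr fun i => ?_
          rw [← inner_conj_symm, ← Complex.norm_conj]
          simp
        refine Summable.of_nonneg_of_le (fun i => norm_nonneg _) (fun i => ?_)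
          ((((C0Seq.summable_sub_sq x y h₁).add (C0Seq.summable_sub_sq z y h₂')).add
            (h₁.add h₂)).add y.summable_sq)
        have e : inner ℂ (x.1 i) (z.1 i) - 1
            = inner ℂ (x.1 i - y.1 i) (z.1 i - y.1 i) + ((inner ℂ (x.1 i) (y.1 i) - 1)
              + (inner ℂ (y.1 i) (z.1 i) - 1)) - ((‖y.1 i‖ ^ 2 - 1 : ℝ) : ℂ) := by
          have := inner_self_eq_norm_sq_to_K (𝕜 := ℂ) (y.1 i)
          simp only [inner_sub_left, inner_sub_right, this]
          push_cast
          simp only [Complex.coe_algebraMap]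
          ring
        rw [e]
        refine (norm_sub_le _ _).trans (add_le_add ((norm_add_le _ _).trans
          (add_le_add ?_ (norm_add_le _ _))) ?_)
        · refine (norm_inner_le_norm _ _).trans ?_
          nlinarith [sq_nonneg (‖x.1 i - y.1 i‖ - ‖z.1 i - y.1 i‖),
            sq_nonneg (‖x.1 i - y.1 i‖), sq_nonneg (‖z.1 i - y.1 i‖)]
        · rw [Complex.norm_real, Real.norm_eq_abs] }

variable (H)

/-- `Ω^un`: the unit families modulo `∼`. -/
def OmegaUn : Type _ := Quotient (UnitSeq.setoid (H := H))

/-- `Γ`: the `C₀`-sequences modulo `≈`. -/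
def GammaC0 : Type _ := Quotient (C0Seq.setoid (H := H))

variable {H}

/-- The class `[x]_∼` of a unit family. -/
def UnitSeq.cls (x : UnitSeq H) : OmegaUn H := Quotient.mk _ x

/-- The class `[x]_≈` of a `C₀`-sequence. -/
def C0Seq.cls (x : C0Seq H) : GammaC0 H := Quotient.mk _ x

/-- A unit family is almost everywhere of norm one. -/
def UnitSeq.toEu (x : UnitSeq H) : EuSeq H := ⟨x.1, by simp [x.2]⟩

/-- A family which is almost everywhere of norm one is a `C₀`-sequence. -/
def EuSeq.toC0 (x : EuSeq H) : C0Seq H :=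
  ⟨x.1, summable_of_hasFiniteSupport (x.2.subset fun i hi h => hi (by simp [h]))⟩

/-- `x ∈ ∏^μ H i`: the family `x` agrees with a representative of `μ` up to finitely many
indices. Such an `x` is automatically almost everywhere of norm one. -/
def EuSeq.MemClass (x : EuSeq H) (μ : OmegaUn H) : Prop :=
  ∃ u : UnitSeq H, u.cls = μ ∧ {i | x.1 i ≠ u.1 i}.Finite

end Sequences

/-! ## Positivity of the product kernels -/

section Kernel

open scoped ComplexConjugate ComplexOrder Matrix

theorem kernel_nonneg {I : Type*} {H : I → Type*} [∀ i, NormedAddCommGroup (H i)]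
    [∀ i, InnerProductSpace ℂ (H i)] {α : Type*} (r : Setoid α) (x : α → ∀ i, H i)
    (K : α → α → ℂ) (h0 : ∀ a b, ¬ r a b → K a b = 0)
    (h1 : ∀ a b, r a b → HasProd (fun i => inner ℂ (x a i) (x b i)) (K a b))
    (s : Finset α) (c : α → ℂ) :
    0 ≤ (∑ a ∈ s, ∑ b ∈ s, conj (c a) * c b * K a b).re := by
  classical
  let KF : Finset I → α → α → ℂ := fun F a b =>
    if r a b then ∏ i ∈ F, inner ℂ (x a i) (x b i) else 0
  have hlim : ∀ a b, Filter.Tendsto (fun F => KF F a b) Filter.atTop (nhds (K a b)) := by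
    intro a b
    by_cases h : r a b
    · have := h1 a b h
      simp only [KF, h, if_true]
      exact this
    · simp only [KF, h, if_false, h0 a b h]
      exact tendsto_const_nhds
  have hpsd : ∀ F, (Matrix.of fun a b : s => KF F a b).PosSemidef := by
    intro F
    induction F using Finset.induction_on with
    | empty =>
      let f : s → Set.range (fun a : s => (Quotient.mk r (a : α))) := fun a => ⟨_, a, rfl⟩
      have e : (Matrix.of fun a b : s => KF ∅ a b) = Matrix.gram ℂ
          (fun a : s => (EuclideanSpace.single (f a) (1 : ℂ) : EuclideanSpace ℂ _)) := by
        ext a b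
        have hf : f a = f b ↔ r a b := by
          rw [Subtype.ext_iff]
          exact Quotient.eq
        simp only [KF, Finset.prod_empty, Matrix.of_apply, Matrix.gram_apply,
          EuclideanSpace.inner_single_left, map_one, one_mul, PiLp.single_apply, hf]
      rw [e]
      exact Matrix.posSemidef_gram ℂ _
    | insert i F hi ih =>
      have e : (Matrix.of fun a b : s => KF (insert i F) a b) =
          (Matrix.of fun a b : s => KF F a b) ⊙ Matrix.gram ℂ (fun a : s => x a i) := by
        ext a b
        simp only [KF, Matrix.of_apply, Matrix.hadamard_apply, Matrix.gram_apply]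
        split_ifs
        · rw [Finset.prod_insert hi, mul_comm]
        · simp
      rw [e]
      exact ih.hadamard (Matrix.posSemidef_gram ℂ (fun a : s => x a i))
  have hF : ∀ F, 0 ≤ (∑ a ∈ s, ∑ b ∈ s, conj (c a) * c b * KF F a b).re := by
    intro F
    have h := (hpsd F).dotProduct_mulVec_nonneg (fun a => c a)
    have h' := (Complex.le_def.1 h).1
    refine h'.trans_eq ?_
    congr 1
    rw [← Finset.sum_coe_sort s]
    simp only [dotProduct, Matrix.mulVec, Finset.mul_sum]
    refine Finset.sum_congr rfl fun a _ => ?_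
    rw [← Finset.sum_coe_sort s]
    refine Finset.sum_congr rfl fun b _ => ?_
    simp only [Pi.star_apply, Matrix.of_apply, RCLike.star_def]
    ring
  refine ge_of_tendsto (x := Filter.atTop)
    (f := fun F => (∑ a ∈ s, ∑ b ∈ s, conj (c a) * c b * KF F a b).re) ?_
    (Filter.Eventually.of_forall hF)
  refine (Complex.continuous_re.tendsto _).comp ?_
  exact tendsto_finsetSum _ fun a _ => tendsto_finsetSum _ fun b _ => (hlim a b).const_mul _

end Kernel

/-! ## The algebraic infinite tensor product and its part spanned by unit families -/

section Tensor

open scoped ComplexConjugate TensorProduct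

open Classical in
/-- `∏ i, β i` if `β i = 1` for all but finitely many `i`, and `0` otherwise. -/
noncomputable def phi1Fun {I : Type*} (β : I → ℂ) : ℂ :=
  if (Function.mulSupport β).Finite then ∏ᶠ i, β i else 0

theorem phi1Fun_update {I : Type*} [DecidableEq I] (β : I → ℂ) (i : I) (z : ℂ) :
    phi1Fun (Function.update β i z) = z * phi1Fun (Function.update β i 1) := by
  have e : Function.update β i z = Function.update (1 : I → ℂ) i z * Function.update β i 1 := by
    ext j
    by_cases h : j = i
    · subst h; simp
    · simp [h]
  have h1 : (Function.mulSupport (Function.update (1 : I → ℂ) i z)).Finite :=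
    (Set.finite_singleton i).subset fun j hj => by
      by_contra h
      exact hj (by simp [show j ≠ i from h])
  have iff : (Function.mulSupport (Function.update β i z)).Finite ↔
      (Function.mulSupport (Function.update β i 1)).Finite := by
    constructor
    · intro h
      refine h.subset fun j hj => ?_
      by_cases hji : j = i
      · subst hji; simp at hj
      · simpa [hji] using hj
    · intro h
      rw [e]
      exact (h1.union h).subset (Function.mulSupport_mul _ _)
  unfold phi1Fun
  by_cases h : (Function.mulSupport (Function.update β i 1)).Finite
  · rw [if_pos h, if_pos (iff.2 h), e]
    have := finprod_mul_distrib h1 h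
    simp only [Pi.mul_apply]
    rw [this]
    congr 1
    rw [finprod_eq_single _ i]
    · simp
    · intro j hj
      simp [hj]
  · rw [if_neg h, if_neg (fun h' => h (iff.1 h')), mul_zero]

/-- The function `phi1Fun` as a multilinear functional on `∏ i, ℂ`. -/
noncomputable def phi1 (I : Type*) : MultilinearMap ℂ (fun _ : I => ℂ) ℂ where
  toFun := phi1Fun
  map_update_add' β i a b := by
    rw [phi1Fun_update, phi1Fun_update β i a, phi1Fun_update β i b, add_mul]
  map_update_smul' β i c a := by
    rw [phi1Fun_update, phi1Fun_update β i a, smul_eq_mul, smul_eq_mul, mul_assoc]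

theorem phi1_conj {I : Type*} (β : I → ℂ) : conj (phi1 I β) = phi1 I fun i => conj (β i) := by
  have hs : (Function.mulSupport fun i => conj (β i)) = Function.mulSupport β := by
    ext i
    simp only [Function.mem_mulSupport, ne_eq, map_eq_one_iff _ (starRingEnd ℂ).injective]
  change conj (phi1Fun β) = phi1Fun fun i => conj (β i)
  unfold phi1Fun
  rw [hs]
  split_ifs with h
  · exact (starRingEnd ℂ).toMonoidHom.map_finprod h
  · simp

variable {I : Type*} (H : I → Type*) [∀ i, NormedAddCommGroup (H i)]
  [∀ i, InnerProductSpace ℂ (H i)]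

variable {H} in
/-- The linear functional on `⨂ i, H i` with `⊗ y i ↦ φ₁ (⟪x i, y i⟫)`. -/
noncomputable def phi1Left (x : ∀ i, H i) : (⨂[ℂ] i, H i) →ₗ[ℂ] ℂ :=
  PiTensorProduct.lift ((phi1 I).compLinearMap fun i => (innerSL ℂ (x i)).toLinearMap)

theorem phi1Left_tprod (x y : ∀ i, H i) :
    phi1Left x (PiTensorProduct.tprod ℂ y) = phi1 I fun i => inner ℂ (x i) (y i) := by
  simp [phi1Left]

/-- The sesquilinear form `⟨ξ, η⟩_{φ₁}` on `⨂ i, H i`, conjugate-linear in `η`; it is determined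
by its values on elementary tensors, see `phi1Form_tprod`. -/
noncomputable def phi1Form : (⨂[ℂ] i, H i) →ₗ[ℂ] (⨂[ℂ] i, H i) →ₗ⋆[ℂ] ℂ :=
  PiTensorProduct.lift
    { toFun := fun x => (starLinearEquiv ℂ (A := ℂ)).toLinearMap.comp (phi1Left x)
      map_update_add' := fun x i a b => by
        have : phi1Left (Function.update x i (a + b)) =
            phi1Left (Function.update x i a) + phi1Left (Function.update x i b) := by
          refine PiTensorProduct.ext (MultilinearMap.ext fun y => ?_)
          have key : ∀ c : H i, (fun j => inner ℂ (Function.update x i c j) (y j)) =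
              Function.update (fun j => inner ℂ (x j) (y j)) i (inner ℂ c (y i)) := by
            intro c
            ext j
            by_cases h : j = i
            · subst h; simp
            · simp [h]
          simp only [LinearMap.compMultilinearMap_apply, LinearMap.add_apply, phi1Left_tprod, key,
            inner_add_left, MultilinearMap.map_update_add]
        rw [this]
        ext η
        simp
      map_update_smul' := fun x i c a => by
        have : phi1Left (Function.update x i (c • a)) =
            conj c • phi1Left (Function.update x i a) := by
          refine PiTensorProduct.ext (MultilinearMap.ext fun y => ?_)
          have key : ∀ c : H i, (fun j => inner ℂ (Function.update x i c j) (y j)) =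
              Function.update (fun j => inner ℂ (x j) (y j)) i (inner ℂ c (y i)) := by
            intro c
            ext j
            by_cases h : j = i
            · subst h; simp
            · simp [h]
          have h2 := (phi1 I).map_update_smul (fun j => inner ℂ (x j) (y j)) i (conj c)
            (inner ℂ a (y i))
          simp only [LinearMap.compMultilinearMap_apply, LinearMap.smul_apply, phi1Left_tprod, key,
            inner_smul_left]
          exact h2
        rw [this]
        ext η
        simp }

theorem phi1Form_tprod (x y : ∀ i, H i) :
    phi1Form H (PiTensorProduct.tprod ℂ x) (PiTensorProduct.tprod ℂ y) =
      phi1 I fun i => inner ℂ (y i) (x i) := by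
  have : phi1Form H (PiTensorProduct.tprod ℂ x) (PiTensorProduct.tprod ℂ y) =
      conj (phi1Left x (PiTensorProduct.tprod ℂ y)) := by
    simp [phi1Form]
  rw [this, phi1Left_tprod, phi1_conj]
  simp only [inner_conj_symm]

/-- `⨂^un H i` as a subspace of `⨂ i, H i`: the span of the tensors of unit families. -/
noncomputable def unSubmodule : Submodule ℂ (⨂[ℂ] i, H i) :=
  Submodule.span ℂ (Set.range fun x : UnitSeq H => PiTensorProduct.tprod ℂ x.1)

/-- The space `⨂^un H i`, to be equipped with the inner product `⟨·, ·⟩_{φ₁}`. -/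
abbrev TensorUn : Type _ := unSubmodule H

theorem phi1Form_conj (ξ η : ⨂[ℂ] i, H i) : conj (phi1Form H ξ η) = phi1Form H η ξ := by
  induction ξ using PiTensorProduct.induction_on with
  | smul_tprod r x =>
    induction η using PiTensorProduct.induction_on with
    | smul_tprod s y =>
      simp only [map_smul, LinearMap.smul_apply, LinearMap.map_smulₛₗ, phi1Form_tprod, smul_eq_mul,
        map_mul, phi1_conj, inner_conj_symm, Complex.conj_conj]
      ring
    | add a b ha hb => simp only [map_add, LinearMap.add_apply, ha, hb]
  | add a b ha hb => simp only [map_add, LinearMap.add_apply, ha, hb]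

theorem phi1Form_nonneg (ξ : TensorUn H) : 0 ≤ (phi1Form H ξ.1 ξ.1).re := by
  obtain ⟨l, hl⟩ := (Finsupp.mem_span_range_iff_exists_finsupp).1 ξ.2
  have hK := kernel_nonneg (H := H) (UnitSeq.setoid (H := H)) (fun x => x.1)
    (fun a b => phi1 I fun i => inner ℂ (a.1 i) (b.1 i)) (fun a b hab => ?_) (fun a b hab => ?_)
    l.support (fun a => l a)
  · refine hK.trans_eq ?_
    rw [← hl]
    simp only [Finsupp.sum, map_sum, LinearMap.sum_apply, map_smul, LinearMap.smul_apply,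
      LinearMap.map_smulₛₗ, phi1Form_tprod, smul_eq_mul, Finset.mul_sum, Complex.re_sum]
    refine Finset.sum_congr rfl fun a _ => Finset.sum_congr rfl fun b _ => ?_
    congr 1
    ring
  · refine if_neg fun h => hab (h.subset fun i hi => ?_)
    rw [Function.mem_mulSupport]
    intro h1
    exact hi ((inner_eq_one_iff_of_norm_eq_one (a.2 i) (b.2 i)).1 h1)
  · have hf : (Function.mulSupport fun i => inner ℂ (a.1 i) (b.1 i)).Finite := by
      refine Set.Finite.subset hab fun i hi h => hi ?_
      change inner ℂ (a.1 i) (b.1 i) = 1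
      rw [show a.1 i = b.1 i from h, inner_self_eq_norm_sq_to_K, b.2 i]
      simp
    have e : phi1 I (fun i => inner ℂ (a.1 i) (b.1 i)) = ∏ᶠ i, inner ℂ (a.1 i) (b.1 i) :=
      if_pos hf
    rw [e, finprod_eq_prod_of_mulSupport_subset (s := hf.toFinset) _ (by simp)]
    refine hasProd_prod_of_ne_finset_one fun i hi => ?_
    by_contra h
    exact hi (by simpa using h)

/-- `⟨·, ·⟩_{φ₁}` on `⨂^un H i`, in the convention of Mathlib (conjugate-linear in the first
variable). -/
noncomputable abbrev TensorUn.core : PreInnerProductSpace.Core ℂ (TensorUn H) where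
  inner ξ η := phi1Form H η.1 ξ.1
  conj_inner_symm _ _ := phi1Form_conj H _ _
  re_inner_nonneg ξ := phi1Form_nonneg H ξ
  add_left ξ η ζ := map_add (phi1Form H ζ.1) ξ.1 η.1
  smul_left ξ η r := LinearMap.map_smulₛₗ (phi1Form H η.1) r ξ.1

noncomputable instance : SeminormedAddCommGroup (TensorUn H) :=
  @InnerProductSpace.Core.toSeminormedAddCommGroup ℂ _ _ _ _ (TensorUn.core H)

noncomputable instance : InnerProductSpace ℂ (TensorUn H) :=
  InnerProductSpace.ofCore (TensorUn.core H)

variable {H}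

theorem tprod_mem_unSubmodule (x : EuSeq H) : PiTensorProduct.tprod ℂ x.1 ∈ unSubmodule H := by
  classical
  by_cases h0 : ∃ i, x.1 i = 0
  · obtain ⟨i, hi⟩ := h0
    rw [(PiTensorProduct.tprod ℂ).map_coord_zero i hi]
    exact zero_mem _
  · push Not at h0
    let u : ∀ i, H i := fun i => ((‖x.1 i‖⁻¹ : ℝ) : ℂ) • x.1 i
    have hu : ∀ i, ‖u i‖ = 1 := fun i => by
      have := norm_ne_zero_iff.2 (h0 i)
      simp [u, norm_smul, this]
    have e : x.1 = x.2.toFinset.piecewise (fun i => (‖x.1 i‖ : ℂ) • u i) u := by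
      ext i
      by_cases hi : i ∈ x.2.toFinset
      · have := norm_ne_zero_iff.2 (h0 i)
        rw [Finset.piecewise_eq_of_mem _ _ _ hi]
        simp [u, smul_smul, this]
      · rw [Finset.piecewise_eq_of_notMem _ _ _ hi]
        have : ‖x.1 i‖ = 1 := by simpa using hi
        simp [u, this]
    rw [e, (PiTensorProduct.tprod ℂ).map_piecewise_smul (fun i => (‖x.1 i‖ : ℂ))]
    exact Submodule.smul_mem _ _ (Submodule.subset_span ⟨⟨u, hu⟩, rfl⟩)

/-- The elementary tensor `⊗ x i` of a family which is almost everywhere of norm one, that is,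
`Θ_H(x)`, as an element of `⨂^un H i`. -/
noncomputable def TensorUn.tprod (x : EuSeq H) : TensorUn H :=
  ⟨PiTensorProduct.tprod ℂ x.1, tprod_mem_unSubmodule x⟩

theorem TensorUn.inner_tprod (x y : EuSeq H) :
    inner ℂ (TensorUn.tprod x) (TensorUn.tprod y) = phi1 I fun i => inner ℂ (x.1 i) (y.1 i) :=
  phi1Form_tprod H y.1 x.1

/-- The subspace `⨂^μ H i` of `⨂^un H i`. -/
noncomputable def tensorMu (μ : OmegaUn H) : Submodule ℂ (TensorUn H) :=
  Submodule.span ℂ (TensorUn.tprod '' {x : EuSeq H | x.MemClass μ})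

end Tensor

/-! ## von Neumann's infinite direct product -/

section DirectProduct

open scoped ComplexConjugate

open Classical in
/-- The value of the infinite product `∏ i, β i` if `∑ i, |β i - 1|` converges, and `0`
otherwise. On families `β i = ⟪x i, y i⟫` with `x`, `y` both `C₀`-sequences this is the value of
the product in von Neumann's sense of quasi-convergence. -/
noncomputable def phi0 {I : Type*} (β : I → ℂ) : ℂ :=
  if Summable (fun i => ‖β i - 1‖) then ∏' i, β i else 0

variable {I : Type*} (H : I → Type*) [∀ i, NormedAddCommGroup (H i)]
  [∀ i, InnerProductSpace ℂ (H i)]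

/-- The vector space of formal linear combinations of `C₀`-sequences. -/
def VNPre : Type _ := C0Seq H →₀ ℂ

noncomputable instance : AddCommGroup (VNPre H) := inferInstanceAs (AddCommGroup (C0Seq H →₀ ℂ))

noncomputable instance : Module ℂ (VNPre H) := inferInstanceAs (Module ℂ (C0Seq H →₀ ℂ))

/-- The identification of finitely supported functions with formal linear combinations. -/
noncomputable def VNPre.of : (C0Seq H →₀ ℂ) ≃ₗ[ℂ] VNPre H := LinearEquiv.refl ℂ _

variable {H} in
/-- The kernel `⟪⊗ x i, ⊗ y i⟫ = ∏ i, ⟪x i, y i⟫` on `C₀`-sequences. -/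
noncomputable def vnKernel (x y : C0Seq H) : ℂ := phi0 fun i => inner ℂ (x.1 i) (y.1 i)

theorem vnKernel_conj (x y : C0Seq H) : conj (vnKernel x y) = vnKernel y x := by
  have h : (Summable fun i => ‖inner ℂ (x.1 i) (y.1 i) - 1‖) ↔
      Summable fun i => ‖inner ℂ (y.1 i) (x.1 i) - 1‖ :=
    ⟨fun h => C0Seq.setoid.symm (a := x) (b := y) h,
      fun h => C0Seq.setoid.symm (a := y) (b := x) h⟩
  unfold vnKernel phi0
  rw [← h]
  split_ifs with h'
  · have hm : Multipliable fun i => inner ℂ (x.1 i) (y.1 i) := by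
      simpa using multipliable_one_add_of_summable h'
    rw [hm.map_tprod (starRingEnd ℂ) Complex.continuous_conj]
    simp only [inner_conj_symm]
  · simp

theorem vnKernel_nonneg (f : C0Seq H →₀ ℂ) :
    0 ≤ (f.sum fun x a => f.sum fun y b => conj a * b * vnKernel x y).re := by
  refine kernel_nonneg (H := H) (C0Seq.setoid (H := H)) (fun x => x.1) vnKernel
    (fun a b hab => if_neg hab) (fun a b hab => ?_) f.support f
  have hm : Multipliable fun i => inner ℂ (a.1 i) (b.1 i) := by
    simpa using multipliable_one_add_of_summable (show Summable _ from hab)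
  have e : vnKernel a b = ∏' i, inner ℂ (a.1 i) (b.1 i) := if_pos hab
  rw [e]
  exact hm.hasProd

/-- The positive semidefinite form on formal combinations given by the product kernel. -/
noncomputable abbrev VNPre.core : PreInnerProductSpace.Core ℂ (VNPre H) where
  inner f g := ((VNPre.of H).symm f).sum fun x a => ((VNPre.of H).symm g).sum fun y b =>
    conj a * b * vnKernel x y
  conj_inner_symm f g := by
    simp only [Finsupp.sum, map_sum, map_mul, Complex.conj_conj, vnKernel_conj]
    rw [Finset.sum_comm]
    refine Finset.sum_congr rfl fun x _ => Finset.sum_congr rfl fun y _ => ?_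
    ring
  re_inner_nonneg f := vnKernel_nonneg H ((VNPre.of H).symm f)
  add_left f g h := by
    rw [map_add]
    refine Finsupp.sum_add_index' (fun x => by simp) fun x a b => ?_
    rw [← Finsupp.sum_add]
    refine Finsupp.sum_congr fun y _ => ?_
    rw [map_add]
    ring
  smul_left f g r := by
    rw [map_smul]
    refine (Finsupp.sum_smul_index' (g := (VNPre.of H).symm f) (b := r)
      (fun x => by simp)).trans ?_
    rw [Finsupp.mul_sum]
    refine Finsupp.sum_congr fun x _ => ?_
    rw [Finsupp.mul_sum]
    refine Finsupp.sum_congr fun y _ => ?_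
    rw [smul_eq_mul, map_mul]
    ring

noncomputable instance : SeminormedAddCommGroup (VNPre H) :=
  @InnerProductSpace.Core.toSeminormedAddCommGroup ℂ _ _ _ _ (VNPre.core H)

noncomputable instance : InnerProductSpace ℂ (VNPre H) :=
  InnerProductSpace.ofCore (VNPre.core H)

/-- von Neumann's infinite direct product `∏⊗ H i`: the Hilbert space obtained by separating and
completing the formal combinations of `C₀`-sequences. -/
abbrev VNProd : Type _ := UniformSpace.Completion (VNPre H)

variable {H}

/-- The element `∏⊗ x i` of the infinite direct product given by a `C₀`-sequence. -/
noncomputable def VNProd.tprod (x : C0Seq H) : VNProd H :=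
  ((VNPre.of H (Finsupp.single x 1) : VNPre H) : UniformSpace.Completion (VNPre H))

theorem VNProd.inner_tprod (x y : C0Seq H) :
    inner ℂ (VNProd.tprod x) (VNProd.tprod y) = phi0 fun i => inner ℂ (x.1 i) (y.1 i) := by
  rw [VNProd.tprod, VNProd.tprod, UniformSpace.Completion.inner_coe]
  change (Finsupp.sum (Finsupp.single x (1 : ℂ)) fun x a =>
    Finsupp.sum (Finsupp.single y (1 : ℂ)) fun y b => conj a * b * vnKernel x y) = _
  simp [vnKernel]

/-- The incomplete product `∏⊗^𝔠 H i`: the closed span of the `∏⊗ x i` with `x` of class `𝔠`. -/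
noncomputable def incompleteProd (c : GammaC0 H) : Submodule ℂ (VNProd H) :=
  (Submodule.span ℂ (VNProd.tprod '' {x : C0Seq H | x.cls = c})).topologicalClosure

end DirectProduct

/-! ## Changing the base point by unitaries -/

/-! Changing finitely many coordinates of a unit family alters only finitely many terms of the
series defining `≈`, so `κ` is well defined; normalising the coordinates of a `C₀`-sequence makes it
surjective. Coordinatewise unitaries preserve both relations, and unitaries taking each `x i` to `y
i` exist, so any two fibres are in bijection.

For `Υ`, von Neumann's kernel is sesquilinear in each coordinate and elementary vectors are total,
so `∏⊗` is multilinear and factors through the algebraic tensor product. Families in one class `μ`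
differ at finitely many indices; their inner products then have finitely many factors other than
`1`, where both kernels agree (`phi0_eq_phi1`), and `Υ` is isometric on `⨂^μ H i`.

Its image there is dense in the incomplete product: for `z ≈ u`, the families equal to `z` on a
finite `F` and to `u` elsewhere lie in the class of `u`, and their tensors tend to that of `z`
(`tendsto_tprod_replace`). An isometry into a Hilbert space extends to the completion with closed
range. -/

/-- After a phase `c` makes `⟪v, c • w⟫` real, the reflection exchanging `v` and `c • w` exists as
in the real case; multiplication by `c⁻¹` then removes the phase. -/
theorem exists_linearIsometryEquiv_apply_eq {E : Type*} [NormedAddCommGroup E]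
    [InnerProductSpace ℂ E] {v w : E} (h : ‖v‖ = ‖w‖) : ∃ W : E ≃ₗᵢ[ℂ] E, W v = w := by
  obtain ⟨c, hc, hcv⟩ : ∃ c : ℂ, ‖c‖ = 1 ∧ c * inner ℂ v w = ‖inner ℂ v w‖ := by
    by_cases h0 : inner ℂ v w = 0
    · exact ⟨1, by simp [h0]⟩
    · have hn : (‖inner ℂ v w‖ : ℂ) ≠ 0 := by simpa using h0
      refine ⟨‖inner ℂ v w‖ / inner ℂ v w, ?_, div_mul_cancel₀ _ h0⟩
      simp [h0]
  have hc0 : c ≠ 0 := fun hc' => by simp [hc'] at hc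
  let T : E ≃ₗᵢ[ℂ] E :=
    { LinearEquiv.smulOfUnit (Units.mk0 c hc0)⁻¹ with
      norm_map' := fun x => by
        change ‖c⁻¹ • x‖ = ‖x‖
        rw [norm_smul, norm_inv, hc, inv_one, one_mul] }
  have hT : ∀ x, T x = c⁻¹ • x := fun x => rfl
  refine ⟨((ℂ ∙ (v - c • w))ᗮ.reflection).trans T, ?_⟩
  have hnorm : ‖v‖ = ‖c • w‖ := by rw [norm_smul, hc, one_mul, h]
  set R := (ℂ ∙ (v - c • w))ᗮ.reflection with hR
  have h1 : R (v - c • w) = -(v - c • w) :=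
    Submodule.reflection_orthogonalComplement_singleton_eq_neg _
  -- The sum is orthogonal to the difference: the norms agree and the mixed inner products, being
  -- real, cancel.
  have h2 : R (v + c • w) = v + c • w := by
    apply Submodule.reflection_mem_subspace_eq_self
    rw [Submodule.mem_orthogonal_singleton_iff_inner_right]
    have hs : inner ℂ (c • w) v = inner ℂ v (c • w) := by
      rw [← inner_conj_symm (c • w) v, inner_smul_right, hcv, Complex.conj_ofReal]
    rw [inner_sub_left, inner_add_right, inner_add_right, hs, inner_self_eq_norm_sq_to_K,
      inner_self_eq_norm_sq_to_K, hnorm]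
    ring
  have h3 : R v = c • w := by
    have h4 : (2 : ℂ) • R v = (2 : ℂ) • (c • w) := by
      rw [← map_smul]
      have : (2 : ℂ) • v = (v - c • w) + (v + c • w) := by rw [two_smul]; abel
      rw [this, map_add, h1, h2, two_smul]
      abel
    exact smul_right_injective E (two_ne_zero (α := ℂ)) h4
  rw [LinearIsometryEquiv.trans_apply, h3, hT, smul_smul, inv_mul_cancel₀ hc0, one_smul]

/-! ### The map `κ` and its fibres -/

section UnitFamilies

variable {I : Type*} {H : I → Type*} [∀ i, NormedAddCommGroup (H i)]
  [∀ i, InnerProductSpace ℂ (H i)]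

/-- A family of unitaries acts on the unit families. -/
def UnitSeq.mapEquiv (W : ∀ i, H i ≃ₗᵢ[ℂ] H i) : UnitSeq H ≃ UnitSeq H where
  toFun x := ⟨fun i => W i (x.1 i), fun i => by simp [x.2 i]⟩
  invFun x := ⟨fun i => (W i).symm (x.1 i), fun i => by simp [x.2 i]⟩
  left_inv x := by ext; simp
  right_inv x := by ext; simp

/-- A family of unitaries acts on `Ω^un`. -/
def OmegaUn.mapEquiv (W : ∀ i, H i ≃ₗᵢ[ℂ] H i) : OmegaUn H ≃ OmegaUn H :=
  Quotient.congr (UnitSeq.mapEquiv W) fun x y => by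
    change Set.Finite {i | x.1 i ≠ y.1 i} ↔ Set.Finite {i | W i (x.1 i) ≠ W i (y.1 i)}
    simp

theorem EuSeq.toC0_cls_eq_of_finite {x y : EuSeq H} (h : {i | x.1 i ≠ y.1 i}.Finite) :
    x.toC0.cls = y.toC0.cls := by
  refine Quotient.sound (summable_of_hasFiniteSupport ((h.union x.2).subset fun i hi => ?_))
  by_contra hcon
  simp only [Set.mem_union, Set.mem_ofPred_eq, not_or, not_not] at hcon
  refine hi ?_
  change ‖inner ℂ (x.1 i) (y.1 i) - 1‖ = 0
  rw [← hcon.1, inner_self_eq_norm_sq_to_K, hcon.2]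
  simp

variable (H) in
/-- The map `κ` with `[x]_∼ ↦ [x]_≈`. -/
def OmegaUn.toGamma : OmegaUn H → GammaC0 H :=
  Quotient.lift (fun x : UnitSeq H => x.toEu.toC0.cls) fun _ _ h =>
    EuSeq.toC0_cls_eq_of_finite h

theorem OmegaUn.toGamma_cls (x : UnitSeq H) : OmegaUn.toGamma H x.cls = x.toEu.toC0.cls := rfl

theorem OmegaUn.toGamma_surjective [∀ i, Nontrivial (H i)] :
    Function.Surjective (OmegaUn.toGamma H) := by
  intro c
  obtain ⟨z, rfl⟩ := Quotient.exists_rep c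
  have key : ∀ i, ∃ u : H i, ‖u‖ = 1 ∧ inner ℂ u (z.1 i) = ‖z.1 i‖ := by
    intro i
    -- At a zero coordinate any unit vector serves, both sides being `0`; nontriviality of `H i`
    -- provides one.
    by_cases h0 : z.1 i = 0
    · obtain ⟨e, he⟩ := exists_norm_eq (H i) zero_le_one
      exact ⟨e, he, by simp [h0]⟩
    · have hn : (‖z.1 i‖ : ℂ) ≠ 0 := by simpa using h0
      refine ⟨(‖z.1 i‖ : ℂ)⁻¹ • z.1 i, by simp [norm_smul, h0], ?_⟩
      rw [inner_smul_left, inner_self_eq_norm_sq_to_K, map_inv₀, Complex.conj_ofReal, sq]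
      exact inv_mul_cancel_left₀ hn _
  choose u hu hz using key
  refine ⟨UnitSeq.cls ⟨u, hu⟩, Quotient.sound (z.2.congr fun i => ?_)⟩
  -- Since `⟪u i, z i⟫ = ‖z i‖`, the series for `u ≈ z` is the one that makes `z` a `C₀`-sequence.
  change |‖z.1 i‖ - 1| = ‖inner ℂ (u i) (z.1 i) - 1‖
  rw [hz, ← Real.norm_eq_abs, ← Complex.norm_real]
  simp

theorem OmegaUn.toGamma_mapEquiv_eq_iff (W : ∀ i, H i ≃ₗᵢ[ℂ] H i) (x : UnitSeq H)
    (μ : OmegaUn H) :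
    OmegaUn.toGamma H (OmegaUn.mapEquiv W μ) = (UnitSeq.mapEquiv W x).toEu.toC0.cls ↔
      OmegaUn.toGamma H μ = x.toEu.toC0.cls := by
  obtain ⟨u, rfl⟩ := Quotient.exists_rep μ
  refine Quotient.eq.trans (Iff.trans ?_ Quotient.eq.symm)
  change Summable (fun i => ‖inner ℂ (W i (u.1 i)) (W i (x.1 i)) - 1‖) ↔
    Summable fun i => ‖inner ℂ (u.1 i) (x.1 i) - 1‖
  simp only [LinearIsometryEquiv.inner_map_map]

/-- The bijection of `Ω^un` induced by unitaries with `W i (x i) = y i` respects `≈`, hence matches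
the two fibres. -/
theorem OmegaUn.nonempty_fiber_equiv (x y : UnitSeq H) :
    Nonempty (OmegaUn.toGamma H ⁻¹' {x.toEu.toC0.cls} ≃
      OmegaUn.toGamma H ⁻¹' {y.toEu.toC0.cls}) := by
  choose W hW using fun i =>
    exists_linearIsometryEquiv_apply_eq ((x.2 i).trans (y.2 i).symm)
  have hy : UnitSeq.mapEquiv W x = y := UnitSeq.ext (funext hW)
  refine ⟨(OmegaUn.mapEquiv W).subtypeEquiv fun μ => ?_⟩
  simp only [Set.mem_preimage, Set.mem_singleton_iff]
  rw [← hy, OmegaUn.toGamma_mapEquiv_eq_iff]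

end UnitFamilies

/-! ## Infinite products -/

/-- One coordinate does not affect summability, so both sides fall in the same branch of `phi0`. The
remaining factor is free of `z`, which gives linearity in each coordinate. -/
theorem phi0_update {I : Type*} [DecidableEq I] (β : I → ℂ) (i : I) (z : ℂ) :
    phi0 (Function.update β i z) = z * phi0 (Function.update β i 1) := by
  have hiff : (Summable fun j => ‖Function.update β i z j - 1‖) ↔
      Summable fun j => ‖Function.update β i 1 j - 1‖ := by
    refine summable_congr_cofinite ((Set.finite_singleton i).subset fun j hj => ?_)
    by_contra h
    exact hj (by simp [show j ≠ i from h])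
  have e : Function.update β i z =
      fun j => Function.update (1 : I → ℂ) i z j * Function.update β i 1 j := by
    ext j
    by_cases h : j = i
    · subst h; simp
    · simp [h]
  have h1 : HasProd (Function.update (1 : I → ℂ) i z) z := by
    have := hasProd_single (f := Function.update (1 : I → ℂ) i z) i
      (fun j hj => by simp [hj])
    simpa using this
  unfold phi0
  by_cases h : Summable fun j => ‖Function.update β i 1 j - 1‖
  · rw [if_pos h, if_pos (hiff.2 h), e]
    have hm : Multipliable (Function.update β i 1) := by
      simpa using multipliable_one_add_of_summable h
    rw [h1.multipliable.tprod_mul hm, h1.tprod_eq]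
  · rw [if_neg h, if_neg (fun h' => h (hiff.1 h')), mul_zero]

/-- Finiteness is essential: with infinitely many factors other than `1`, `phi1` vanishes while
`phi0` may be a nonzero convergent product. -/
theorem phi0_eq_phi1 {I : Type*} {β : I → ℂ} (h : (Function.mulSupport β).Finite) :
    phi0 β = phi1 I β := by
  have e : phi1 I β = ∏ᶠ i, β i := if_pos h
  have h0 : Summable fun i => ‖β i - 1‖ :=
    summable_of_hasFiniteSupport (h.subset fun i hi h' => hi (by simp [h']))
  rw [e, phi0, if_pos h0, tprod_eq_finprod h]

/-- The bound for finite products passes to the limit. -/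
theorem norm_tprod_one_add_sub_one_le {I : Type*} {f : I → ℂ} (hf : Summable fun i => ‖f i‖) :
    ‖∏' i, (1 + f i) - 1‖ ≤ Real.exp (∑' i, ‖f i‖) - 1 := by
  have h1 := (multipliable_one_add_of_summable hf).hasProd
  refine le_of_tendsto ((h1.sub_const 1).norm) (Filter.Eventually.of_forall fun t => ?_)
  refine (t.norm_prod_one_add_sub_one_le f).trans ?_
  gcongr
  exact hf.sum_le_tsum _ fun _ _ => norm_nonneg _

open Classical in
/-- The products of the tails of an absolutely convergent product tend to `1`. -/
theorem tendsto_tprod_ite_mem {I : Type*} {β : I → ℂ} (hβ : Summable fun i => ‖β i - 1‖) :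
    Filter.Tendsto (fun F : Finset I => ∏' i, if i ∈ F then 1 else β i) Filter.atTop
      (nhds 1) := by
  rw [tendsto_iff_norm_sub_tendsto_zero]
  have h0 := tendsto_tsum_compl_atTop_zero fun i => ‖β i - 1‖
  have h1 : Filter.Tendsto (fun F : Finset I =>
      Real.exp (∑' i : {i // i ∉ F}, ‖β i - 1‖) - 1) Filter.atTop (nhds 0) := by
    simpa using ((Real.continuous_exp.tendsto _).comp h0).sub_const 1
  refine squeeze_zero (fun _ => norm_nonneg _) (fun F => ?_) h1
  have e : ∀ i, (if i ∈ F then 1 else β i) =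
      1 + Set.indicator {i | i ∉ F} (fun i => β i - 1) i := by
    intro i
    by_cases hi : i ∈ F <;> simp [hi]
  have hn : ∀ i, ‖Set.indicator {i | i ∉ F} (fun i => β i - 1) i‖ =
      Set.indicator {i | i ∉ F} (fun i => ‖β i - 1‖) i :=
    fun i => norm_indicator_eq_indicator_norm _ _
  simp only [e]
  refine (norm_tprod_one_add_sub_one_le ?_).trans_eq ?_
  · simp only [hn]
    exact hβ.indicator _
  · simp only [hn]
    rw [← tsum_subtype]
    rfl

section DirectProduct

variable {I : Type*} {H : I → Type*} [∀ i, NormedAddCommGroup (H i)]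
  [∀ i, InnerProductSpace ℂ (H i)]

/-! ## Multilinearity of the elementary tensors -/

theorem VNProd.span_range_tprod_dense :
    Dense (Submodule.span ℂ (Set.range (VNProd.tprod (H := H))) : Set (VNProd H)) := by
  refine UniformSpace.Completion.denseRange_coe.mono ?_
  rintro _ ⟨f, rfl⟩
  obtain ⟨g, rfl⟩ := (VNPre.of H).surjective f
  induction g using Finsupp.induction_linear with
  | zero =>
    rw [map_zero, UniformSpace.Completion.coe_zero]
    exact zero_mem _
  | add a b ha hb =>
    rw [map_add, UniformSpace.Completion.coe_add]
    exact add_mem ha hb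
  | single x c =>
    have : Finsupp.single x c = c • Finsupp.single x (1 : ℂ) := by simp
    rw [this, map_smul, UniformSpace.Completion.coe_smul]
    exact Submodule.smul_mem _ _ (Submodule.subset_span ⟨x, rfl⟩)

/-- Elementary vectors are total, so identities between vectors, such as multilinearity, can be
tested on the kernel. -/
theorem VNProd.ext_inner_tprod {v w : VNProd H}
    (h : ∀ y : C0Seq H, inner ℂ (VNProd.tprod y) v = inner ℂ (VNProd.tprod y) w) : v = w := by
  refine VNProd.span_range_tprod_dense.eq_of_inner_right ℂ fun u hu => ?_
  induction hu using Submodule.span_induction with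
  | mem u hu => obtain ⟨y, rfl⟩ := hu; exact h y
  | zero => simp
  | add a b _ _ ha hb => rw [inner_add_left, inner_add_left, ha, hb]
  | smul c a _ ha => rw [inner_smul_left, inner_smul_left, ha]

theorem VNProd.inner_tprod_of_eq_update [DecidableEq I] (y z : C0Seq H) (x : ∀ i, H i) (i : I)
    (c : H i) (hz : z.1 = Function.update x i c) :
    inner ℂ (VNProd.tprod y) (VNProd.tprod z) = inner ℂ (y.1 i) c *
      phi0 (Function.update (fun j => inner ℂ (y.1 j) (x j)) i 1) := by
  rw [VNProd.inner_tprod, ← phi0_update, hz]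
  congr 1
  ext j
  by_cases h : j = i
  · subst h; simp
  · simp [h]

theorem finite_norm_update_ne_one_iff [DecidableEq I] (x : ∀ i, H i) (i : I) (a b : H i) :
    {j | ‖Function.update x i a j‖ ≠ 1}.Finite ↔
      {j | ‖Function.update x i b j‖ ≠ 1}.Finite := by
  have key : ∀ a b : H i, {j | ‖Function.update x i a j‖ ≠ 1}.Finite →
      {j | ‖Function.update x i b j‖ ≠ 1}.Finite := by
    intro a b h
    refine (h.union (Set.finite_singleton i)).subset fun j hj => ?_
    by_cases hji : j = i
    · exact Or.inr hji
    · left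
      simpa [hji] using hj
  exact ⟨key a b, key b a⟩

open Classical in
variable (H) in
/-- The multilinear map with `x ↦ ∏⊗ x i` if `x` is almost everywhere of norm one, and `x ↦ 0`
otherwise. -/
noncomputable def VNProd.tprodMultilinear : MultilinearMap ℂ H (VNProd H) where
  -- The universal property needs a map on the whole product. The default `0` keeps multilinearity
  -- because altering one coordinate never changes the branch.
  toFun x := if h : {i | ‖x i‖ ≠ 1}.Finite then VNProd.tprod (EuSeq.toC0 ⟨x, h⟩) else 0
  map_update_add' {inst} x i a b := by
    have ha := finite_norm_update_ne_one_iff x i a (a + b)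
    have hb := finite_norm_update_ne_one_iff x i b (a + b)
    by_cases h : {j | ‖Function.update x i (a + b) j‖ ≠ 1}.Finite
    · rw [dif_pos h, dif_pos (ha.2 h), dif_pos (hb.2 h)]
      refine VNProd.ext_inner_tprod fun y => ?_
      rw [inner_add_right, VNProd.inner_tprod_of_eq_update y _ x i (a + b) rfl,
        VNProd.inner_tprod_of_eq_update y _ x i a rfl,
        VNProd.inner_tprod_of_eq_update y _ x i b rfl, inner_add_right, add_mul]
    · rw [dif_neg h, dif_neg (mt ha.1 h), dif_neg (mt hb.1 h), add_zero]
  map_update_smul' {inst} x i c a := by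
    have ha := finite_norm_update_ne_one_iff x i a (c • a)
    by_cases h : {j | ‖Function.update x i (c • a) j‖ ≠ 1}.Finite
    · rw [dif_pos h, dif_pos (ha.2 h)]
      refine VNProd.ext_inner_tprod fun y => ?_
      rw [inner_smul_right, VNProd.inner_tprod_of_eq_update y _ x i (c • a) rfl,
        VNProd.inner_tprod_of_eq_update y _ x i a rfl, inner_smul_right, mul_assoc]
    · rw [dif_neg h, dif_neg (mt ha.1 h), smul_zero]

variable (H) in
/-- The linear map `⨂^un H i → ∏⊗ H i` with `⊗ x i ↦ ∏⊗ x i`. -/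
noncomputable def TensorUn.toVNProd : TensorUn H →ₗ[ℂ] VNProd H :=
  (PiTensorProduct.lift (VNProd.tprodMultilinear H)).comp (unSubmodule H).subtype

theorem TensorUn.toVNProd_tprod (x : EuSeq H) :
    TensorUn.toVNProd H (TensorUn.tprod x) = VNProd.tprod x.toC0 := by
  have : TensorUn.toVNProd H (TensorUn.tprod x) = VNProd.tprodMultilinear H x.1 :=
    PiTensorProduct.lift.tprod x.1
  rw [this]
  exact dif_pos x.2

/-! ## The restriction to `⨂^μ H i` is isometric -/

theorem EuSeq.MemClass.finite_ne {x y : EuSeq H} {μ : OmegaUn H} (hx : x.MemClass μ)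
    (hy : y.MemClass μ) : {i | x.1 i ≠ y.1 i}.Finite := by
  obtain ⟨u, hu, hxu⟩ := hx
  obtain ⟨v, hv, hyv⟩ := hy
  have huv : {i | u.1 i ≠ v.1 i}.Finite := Quotient.exact (hu.trans hv.symm)
  refine ((hxu.union huv).union hyv).subset fun i hi => ?_
  by_contra hcon
  simp only [Set.mem_union, Set.mem_ofPred_eq, not_or, not_not] at hcon
  exact hi (hcon.1.1.trans (hcon.1.2.trans hcon.2.symm))

theorem EuSeq.finite_mulSupport_inner {x y : EuSeq H} (h : {i | x.1 i ≠ y.1 i}.Finite) :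
    (Function.mulSupport fun i => inner ℂ (x.1 i) (y.1 i)).Finite := by
  refine (h.union x.2).subset fun i hi => ?_
  by_contra hcon
  simp only [Set.mem_union, Set.mem_ofPred_eq, not_or, not_not] at hcon
  refine hi ?_
  change inner ℂ (x.1 i) (y.1 i) = 1
  rw [← hcon.1, inner_self_eq_norm_sq_to_K, hcon.2]
  simp

/-- Sesquilinearity reduces this to elementary tensors, where the families differ at finitely many
indices and the kernels coincide. Both vectors must come from the same `μ`: distinct classes are
orthogonal for `φ₁`, but their images need not be when `κ` identifies them. -/
theorem TensorUn.inner_toVNProd {μ : OmegaUn H} {ξ η : TensorUn H} (hξ : ξ ∈ tensorMu μ)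
    (hη : η ∈ tensorMu μ) :
    inner ℂ (TensorUn.toVNProd H ξ) (TensorUn.toVNProd H η) = inner ℂ ξ η := by
  induction hξ using Submodule.span_induction with
  | mem ξ hξ =>
    obtain ⟨x, hx, rfl⟩ := hξ
    induction hη using Submodule.span_induction with
    | mem η hη =>
      obtain ⟨y, hy, rfl⟩ := hη
      rw [TensorUn.toVNProd_tprod, TensorUn.toVNProd_tprod, VNProd.inner_tprod,
        TensorUn.inner_tprod]
      exact phi0_eq_phi1 (EuSeq.finite_mulSupport_inner (EuSeq.MemClass.finite_ne hx hy))
    | zero => simp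
    | add a b _ _ ha hb => rw [map_add, inner_add_right, inner_add_right, ha, hb]
    | smul c a _ ha => rw [map_smul, inner_smul_right, inner_smul_right, ha]
  | zero => simp
  | add a b _ _ ha hb => rw [map_add, inner_add_left, inner_add_left, ha, hb]
  | smul c a _ ha => rw [map_smul, inner_smul_left, inner_smul_left, ha]

/-- The isometric restriction of `TensorUn.toVNProd` to `⨂^μ H i`. -/
noncomputable def tensorMu.toVNProd (μ : OmegaUn H) : tensorMu μ →ₗᵢ[ℂ] VNProd H where
  toLinearMap := (TensorUn.toVNProd H).comp (tensorMu μ).subtype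
  norm_map' ξ := by
    have h := TensorUn.inner_toVNProd ξ.2 ξ.2
    change ‖TensorUn.toVNProd H ξ.1‖ = ‖ξ.1‖
    rw [@norm_eq_sqrt_re_inner ℂ, @norm_eq_sqrt_re_inner ℂ _ _ _ _ ξ.1, h]

/-! ## Density in the incomplete product -/

theorem EuSeq.MemClass.toC0_cls {x : EuSeq H} {μ : OmegaUn H} (hx : x.MemClass μ) :
    x.toC0.cls = OmegaUn.toGamma H μ := by
  obtain ⟨u, rfl, h⟩ := hx
  exact EuSeq.toC0_cls_eq_of_finite h

open Classical in
/-- The family equal to `z` on `F` and to the unit family `u` outside `F`. -/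
noncomputable def UnitSeq.replace (u : UnitSeq H) (z : ∀ i, H i) (F : Finset I) : EuSeq H :=
  ⟨fun i => if i ∈ F then z i else u.1 i, F.finite_toSet.subset fun i hi => by
    by_contra h
    exact hi (by simp [show i ∉ F from h, u.2 i])⟩

theorem UnitSeq.replace_memClass (u : UnitSeq H) (z : ∀ i, H i) (F : Finset I) :
    (u.replace z F).MemClass u.cls := by
  refine ⟨u, rfl, F.finite_toSet.subset fun i hi => ?_⟩
  by_contra h
  exact hi (by simp [UnitSeq.replace, show i ∉ F from h])

/-- With `P = ∏ ‖z i‖ ^ 2`, both the squared norm of the replaced tensor and its inner product with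
the tensor of `z` tend to `P`, so the squared distance tends to `P - 2 * P + P = 0`. -/
theorem tendsto_tprod_replace (u : UnitSeq H) (z : C0Seq H) (h : z.cls = u.toEu.toC0.cls) :
    Filter.Tendsto (fun F => VNProd.tprod (u.replace z.1 F).toC0) Filter.atTop
      (nhds (VNProd.tprod z)) := by
  classical
  have hzu : Summable fun i => ‖inner ℂ (z.1 i) (u.1 i) - 1‖ := Quotient.exact h
  have hzz : Summable fun i => ‖inner ℂ (z.1 i) (z.1 i) - 1‖ := C0Seq.setoid.refl z
  have hm : Multipliable fun i => inner ℂ (z.1 i) (z.1 i) := by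
    simpa using multipliable_one_add_of_summable hzz
  set P := ∏' i, inner ℂ (z.1 i) (z.1 i) with hP
  have hself : inner ℂ (VNProd.tprod z) (VNProd.tprod z) = P := by
    rw [VNProd.inner_tprod, phi0, if_pos hzz]
  have hFF : ∀ F, inner ℂ (VNProd.tprod (u.replace z.1 F).toC0)
      (VNProd.tprod (u.replace z.1 F).toC0) = ∏ i ∈ F, inner ℂ (z.1 i) (z.1 i) := by
    intro F
    have hs : Summable fun i => ‖inner ℂ ((u.replace z.1 F).toC0.1 i)
      ((u.replace z.1 F).toC0.1 i) - 1‖ := C0Seq.setoid.refl (u.replace z.1 F).toC0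
    rw [VNProd.inner_tprod, phi0, if_pos hs, tprod_eq_prod (s := F)]
    · refine Finset.prod_congr rfl fun i hi => ?_
      simp [EuSeq.toC0, UnitSeq.replace, hi]
    · intro i hi
      simp [EuSeq.toC0, UnitSeq.replace, hi, inner_self_eq_norm_sq_to_K, u.2 i]
  have hzF : ∀ F, inner ℂ (VNProd.tprod z) (VNProd.tprod (u.replace z.1 F).toC0) =
      (∏ i ∈ F, inner ℂ (z.1 i) (z.1 i)) *
        ∏' i, if i ∈ F then 1 else inner ℂ (z.1 i) (u.1 i) := by
    intro F
    have hs : Summable fun i => ‖inner ℂ (z.1 i) ((u.replace z.1 F).toC0.1 i) - 1‖ :=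
      Quotient.exact (h.trans (UnitSeq.replace_memClass u z.1 F).toC0_cls.symm)
    -- Padding the finite part and the tail with ones lets them be multiplied termwise. No division
    -- occurs, so vanishing factors do no harm.
    have h1 : HasProd (fun i => if i ∈ F then inner ℂ (z.1 i) (z.1 i) else 1)
        (∏ i ∈ F, inner ℂ (z.1 i) (z.1 i)) := by
      have := hasProd_prod_of_ne_finset_one (s := F)
        (f := fun i => if i ∈ F then inner ℂ (z.1 i) (z.1 i) else 1)
        (L := SummationFilter.unconditional I) (fun i hi => if_neg hi)
      rwa [Finset.prod_congr rfl fun i hi => if_pos hi] at this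
    have h2 : Multipliable fun i => if i ∈ F then 1 else inner ℂ (z.1 i) (u.1 i) := by
      have : Summable fun i => ‖(if i ∈ F then 1 else inner ℂ (z.1 i) (u.1 i)) - 1‖ := by
        refine hzu.of_nonneg_of_le (fun _ => norm_nonneg _) fun i => ?_
        by_cases hi : i ∈ F <;> simp [hi]
      simpa using multipliable_one_add_of_summable this
    rw [VNProd.inner_tprod, phi0, if_pos hs, ← h1.tprod_eq, ← h1.multipliable.tprod_mul h2]
    refine tprod_congr fun i => ?_
    by_cases hi : i ∈ F <;> simp [EuSeq.toC0, UnitSeq.replace, hi]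
  have hlim : Filter.Tendsto (fun F => inner ℂ (VNProd.tprod z)
      (VNProd.tprod (u.replace z.1 F).toC0)) Filter.atTop (nhds P) := by
    simp only [hzF]
    rw [← mul_one P]
    exact Filter.Tendsto.mul hm.hasProd (tendsto_tprod_ite_mem hzu)
  have hlim' : Filter.Tendsto (fun F => inner ℂ (VNProd.tprod (u.replace z.1 F).toC0)
      (VNProd.tprod (u.replace z.1 F).toC0)) Filter.atTop (nhds P) := by
    simp only [hFF]
    exact hm.hasProd
  rw [tendsto_iff_norm_sub_tendsto_zero]
  have hsq : Filter.Tendsto (fun F => ‖VNProd.tprod (u.replace z.1 F).toC0 - VNProd.tprod z‖ ^ 2)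
      Filter.atTop (nhds 0) := by
    have e : ∀ F, ‖VNProd.tprod (u.replace z.1 F).toC0 - VNProd.tprod z‖ ^ 2 =
        (inner ℂ (VNProd.tprod (u.replace z.1 F).toC0)
          (VNProd.tprod (u.replace z.1 F).toC0)).re -
        2 * (inner ℂ (VNProd.tprod z) (VNProd.tprod (u.replace z.1 F).toC0)).re + P.re := by
      intro F
      rw [norm_sub_rev, @norm_sub_sq ℂ, ← hself, ← @inner_self_eq_norm_sq ℂ,
        ← @inner_self_eq_norm_sq ℂ]
      simp only [RCLike.re_to_complex]
      ring
    simp only [e]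
    have := ((Complex.continuous_re.tendsto _).comp hlim').sub
      (((Complex.continuous_re.tendsto _).comp hlim).const_mul 2) |>.add_const P.re
    rwa [show P.re - 2 * P.re + P.re = 0 by ring] at this
  have := hsq.sqrt
  simpa using this

/-- A family in `∏^μ H i` has `≈`-class `κ μ`, which gives one inclusion; approximation by replaced
families gives the other. -/
theorem closure_range_tensorMu_toVNProd (μ : OmegaUn H) :
    ((LinearMap.range (tensorMu.toVNProd μ).toLinearMap).topologicalClosure) =
      incompleteProd (OmegaUn.toGamma H μ) := by
  have hmem : ∀ x : EuSeq H, x.MemClass μ →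
      VNProd.tprod x.toC0 ∈ LinearMap.range (tensorMu.toVNProd μ).toLinearMap := fun x hx =>
    ⟨⟨TensorUn.tprod x, Submodule.subset_span ⟨x, hx, rfl⟩⟩, TensorUn.toVNProd_tprod x⟩
  refine le_antisymm ?_ ?_
  · refine Submodule.topologicalClosure_mono ?_
    suffices h : tensorMu μ ≤ (Submodule.span ℂ (VNProd.tprod ''
        {x : C0Seq H | x.cls = OmegaUn.toGamma H μ})).comap (TensorUn.toVNProd H) by
      rintro _ ⟨ξ, rfl⟩
      exact h ξ.2
    refine Submodule.span_le.2 ?_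
    rintro _ ⟨x, hx, rfl⟩
    rw [SetLike.mem_coe, Submodule.mem_comap]
    rw [TensorUn.toVNProd_tprod]
    exact Submodule.subset_span ⟨x.toC0, EuSeq.MemClass.toC0_cls hx, rfl⟩
  · refine Submodule.topologicalClosure_minimal _ (Submodule.span_le.2 ?_)
      (Submodule.isClosed_topologicalClosure _)
    rintro _ ⟨z, hz, rfl⟩
    obtain ⟨u, rfl⟩ := Quotient.exists_rep μ
    exact mem_closure_of_tendsto (tendsto_tprod_replace u z hz)
      (Filter.Eventually.of_forall fun F => hmem _ (UnitSeq.replace_memClass u z.1 F))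

end DirectProduct

/-! ### Extension to completions and conclusion -/

/-- A linear isometry into a Hilbert space induces an isomorphism of the completion of its domain
with the closure of its range. -/
theorem LinearIsometry.exists_completion_equiv {E G : Type*} [SeminormedAddCommGroup E]
    [NormedSpace ℂ E] [NormedAddCommGroup G] [NormedSpace ℂ G] [CompleteSpace G]
    (L : E →ₗᵢ[ℂ] G) (K : Submodule ℂ G)
    (hK : (LinearMap.range L.toLinearMap).topologicalClosure = K) :
    ∃ U : UniformSpace.Completion E ≃ₗᵢ[ℂ] K, ∀ ξ : E, (U (ξ : UniformSpace.Completion E) : G) =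
      L ξ := by
  have hd : DenseRange (UniformSpace.Completion.toComplL (𝕜 := ℂ) (E := E)) :=
    UniformSpace.Completion.denseRange_coe
  let T : UniformSpace.Completion E →L[ℂ] G :=
    L.toContinuousLinearMap.extend UniformSpace.Completion.toComplL
  -- `E` is only seminormed, so its map to the completion need not be injective; being uniformly
  -- inducing with dense range suffices.
  have hT : ∀ ξ : E, T (ξ : UniformSpace.Completion E) = L ξ := fun ξ =>
    ContinuousLinearMap.extend_eq _ hd (UniformSpace.Completion.isUniformInducing_coe E) ξ
  have hn : ∀ x, ‖T x‖ = ‖x‖ := fun x => by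
    induction x using UniformSpace.Completion.induction_on with
    | hp => exact isClosed_eq (by fun_prop) (by fun_prop)
    | ih ξ => rw [hT, L.norm_map, UniformSpace.Completion.norm_coe]
  let T' : UniformSpace.Completion E →ₗᵢ[ℂ] G := ⟨T.toLinearMap, hn⟩
  -- An isometric image of a complete space is closed, so the range is all of the closure.
  have hcl : IsClosed (Set.range T') := T'.isometry.isClosedEmbedding.isClosed_range
  have hrange : LinearMap.range T'.toLinearMap = K := by
    rw [← hK]
    refine le_antisymm ?_ ?_
    · rintro _ ⟨x, rfl⟩
      change T x ∈ _
      induction x using UniformSpace.Completion.induction_on with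
      | hp => exact (Submodule.isClosed_topologicalClosure _).preimage T.continuous
      | ih ξ =>
        rw [hT]
        exact Submodule.le_topologicalClosure _ ⟨ξ, rfl⟩
    · refine Submodule.topologicalClosure_minimal _ ?_ hcl
      rintro _ ⟨ξ, rfl⟩
      exact ⟨ξ, hT ξ⟩
  subst hrange
  exact ⟨T'.equivRange, hT⟩

theorem mainTheorem12 {I : Type*} [Infinite I] (H : I → Type*)
    [∀ i, NormedAddCommGroup (H i)] [∀ i, InnerProductSpace ℂ (H i)]
    [∀ i, CompleteSpace (H i)] [∀ i, Nontrivial (H i)] :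
    ∃ κ : OmegaUn H → GammaC0 H,
      (∀ x : UnitSeq H, κ x.cls = x.toEu.toC0.cls) ∧
      Function.Surjective κ ∧
      (∀ x y : UnitSeq H,
        Nonempty (κ ⁻¹' {x.toEu.toC0.cls} ≃ κ ⁻¹' {y.toEu.toC0.cls})) ∧
      ∃ Υ : TensorUn H →ₗ[ℂ] VNProd H,
        (∀ x : EuSeq H, Υ (TensorUn.tprod x) = VNProd.tprod x.toC0) ∧
        ∀ μ : OmegaUn H,
          ∃ U : UniformSpace.Completion (tensorMu μ) ≃ₗᵢ[ℂ] incompleteProd (κ μ),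
            ∀ ξ : tensorMu μ, (U (ξ : UniformSpace.Completion (tensorMu μ)) : VNProd H) = Υ ξ := by
  exact ⟨OmegaUn.toGamma H, OmegaUn.toGamma_cls, OmegaUn.toGamma_surjective,
    OmegaUn.nonempty_fiber_equiv, TensorUn.toVNProd H, TensorUn.toVNProd_tprod, fun μ =>
      (tensorMu.toVNProd μ).exists_completion_equiv _ (closure_range_tensorMu_toVNProd μ)⟩
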